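/- Let $\Sigma$ be a finitary signature, i.e. a (possibly many-sorted) set of operation and relation symbols, all of finite arity. Let $\mathrm{Emb}(\Sigma)$ be the category whose objects are the $\Sigma$-structures and whose morphisms are the substructure embeddings (injective homomorphisms that reflect all relations); $|A|$ denotes the cardinality of the underlying set of a structure $A$ (the disjoint union of its sorts). Let $\mathcal K$ be a nearly full subcategory of $\mathrm{Emb}(\Sigma)$: a subcategory such that whenever $h\colon A\to C$ and $g\colon B\to C$ are morphisms of $\mathcal K$ and $f\colon A\to B$ is a morphism of $\mathrm{Emb}(\Sigma)$ with $g f=h$, then $f$ is a morphism of $\mathcal K$. Say that $\mathcal K$ is closed under directed colimits in $\mathrm{Emb}(\Sigma)$ if for every diagram $D\colon I\to\mathcal K$ indexed by a (nonempty, small) directed poset $I$, every colimit cocone of $D$ in $\mathrm{Emb}(\Sigma)$ has its vertex and its legs in $\mathcal K$ and is a colimit cocone of $D$ in $\mathcal K$. Call $\mathcal K$ an abstract elementary class if it is closed under directed colimits in $\mathrm{Emb}(\Sigma)$ and there is a cardinal $\lambda$ such that for every substructure embedding $f\colon A\to B$ with $B\in\mathcal K$ there is a morphism $h\colon A'\to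 B$ of $\mathcal K$ such that $f$ factorizes through $h$ in $\mathrm{Emb}(\Sigma)$ and $|A'|\le |A|+\lambda$. Then $\mathcal K$ is an abstract elementary class if and only if $\mathcal K$ is an accessible category and $\mathcal K$ is closed under directed colimits in $\mathrm{Emb}(\Sigma)$. Here a category is accessible if, for some regular cardinal $\lambda$, it has $\lambda$-directed colimits and a set $\mathcal A$ of $\lambda$-presentable objects (objects $K$ such that $\hom(K,-)$ preserves $\lambda$-directed colimits) such that every object is a $\lambda$-directed colimit of objects from $\mathcal A$. -/

import Mathlib

open CategoryTheory CategoryTheory.Limits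

universe w v u

/-- A finitary many-sorted signature: a set of sorts, a set of operation symbols
`s₁ × ⋯ × sₙ → s` and a set of relation symbols on `s₁ × ⋯ × sₙ`, all of finite arity. -/
structure FinitarySignature : Type (w + 1) where
  /-- the sorts -/
  Sorts : Type w
  /-- the operation symbols -/
  Op : Type w
  /-- the relation symbols -/
  Rel : Type w
  /-- the number of arguments of an operation symbol -/
  opArity : Op → ℕ
  /-- the sorts of the arguments of an operation symbol -/
  opDom : ∀ o : Op, Fin (opArity o) → Sorts
  /-- the sort of the value of an operation symbol -/
  opCod : Op → Sorts
  /-- the number of arguments of a relation symbol -/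
  relArity : Rel → ℕ
  /-- the sorts of the arguments of a relation symbol -/
  relDom : ∀ r : Rel, Fin (relArity r) → Sorts

/-- The objects of the category `Emb(S)`: the structures for the signature `S`. -/
structure EmbCat (S : FinitarySignature.{w}) : Type (w + 1) where
  /-- the underlying set of each sort -/
  carrier : S.Sorts → Type w
  /-- the interpretation of the operation symbols -/
  op : ∀ o : S.Op, (∀ i, carrier (S.opDom o i)) → carrier (S.opCod o)
  /-- the interpretation of the relation symbols -/
  rel : ∀ r : S.Rel, (∀ i, carrier (S.relDom r i)) → Prop

namespace EmbCat

variable {S : FinitarySignature.{w}}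

/-- The cardinality `|A|` of the underlying set of `A`, which is the disjoint union of the
underlying sets of the sorts. -/
def card (A : EmbCat S) : Cardinal.{w} := Cardinal.mk (Σ s : S.Sorts, A.carrier s)

/-- Substructure embeddings: injective homomorphisms that reflect all relations. -/
@[ext]
structure Hom (A B : EmbCat S) : Type w where
  /-- the underlying map in each sort -/
  map : ∀ s, A.carrier s → B.carrier s
  injective : ∀ s, Function.Injective (map s)
  map_op : ∀ (o : S.Op) (x : ∀ i, A.carrier (S.opDom o i)),
    map _ (A.op o x) = B.op o (fun i => map _ (x i))
  map_rel : ∀ (r : S.Rel) (x : ∀ i, A.carrier (S.relDom r i)),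
    B.rel r (fun i => map _ (x i)) ↔ A.rel r x

/-- The category `Emb(S)` of structures and substructure embeddings. -/
instance : Category.{w} (EmbCat S) where
  Hom := Hom
  id A :=
    { map := fun _ x => x
      injective := fun _ _ _ h => h
      map_op := fun _ _ => rfl
      map_rel := fun _ _ => Iff.rfl }
  comp f g :=
    { map := fun s x => g.map s (f.map s x)
      injective := fun s => (g.injective s).comp (f.injective s)
      map_op := fun o x => by rw [f.map_op, g.map_op]
      map_rel := fun r x => (g.map_rel r _).trans (f.map_rel r x) }

end EmbCat

/-- A functor `H` is nearly full if every morphism `f : H A ⟶ H B` that fits in a commutative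
triangle with `H h : H A ⟶ H C` and `H g : H B ⟶ H C` is in the image of `H`. -/
def CategoryTheory.Functor.NearlyFull {K : Type*} [Category* K] {L : Type*} [Category* L]
    (H : K ⥤ L) : Prop :=
  ∀ ⦃A B C : K⦄ (h : A ⟶ C) (g : B ⟶ C) (f : H.obj A ⟶ H.obj B),
    f ≫ H.map g = H.map h → ∃ f' : A ⟶ B, H.map f' = f

/-- A (not necessarily full) subcategory of `L`: a class of objects and a class of morphisms
between them, which contains the identities and is closed under composition. -/
structure Subcat (L : Type u) [Category.{v} L] where
  /-- the objects of the subcategory -/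
  obj : ObjectProperty L
  /-- the morphisms of the subcategory -/
  hom : MorphismProperty L
  source_mem : ∀ ⦃X Y : L⦄ (f : X ⟶ Y), hom f → obj X
  target_mem : ∀ ⦃X Y : L⦄ (f : X ⟶ Y), hom f → obj Y
  id_mem : ∀ X : L, obj X → hom (𝟙 X)
  comp_mem : ∀ ⦃X Y Z : L⦄ (f : X ⟶ Y) (g : Y ⟶ Z), hom f → hom g → hom (f ≫ g)

namespace Subcat

variable {L : Type u} [Category.{v} L] (K : Subcat L)

/-- The objects of the subcategory `K`, as a type. -/
structure Obj : Type u where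
  /-- the object of the ambient category -/
  val : L
  property : K.obj val

/-- The morphisms of the subcategory `K`, as a type. -/
@[ext]
structure Hom (X Y : K.Obj) : Type v where
  /-- the morphism of the ambient category -/
  val : X.val ⟶ Y.val
  property : K.hom val

/-- The subcategory `K`, as a category. -/
instance : Category.{v} K.Obj where
  Hom X Y := K.Hom X Y
  id X := ⟨𝟙 X.val, K.id_mem _ X.property⟩
  comp f g := ⟨f.val ≫ g.val, K.comp_mem _ _ f.property g.property⟩
  id_comp f := Hom.ext (Category.id_comp f.val)
  comp_id f := Hom.ext (Category.comp_id f.val)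
  assoc f g h := Hom.ext (Category.assoc f.val g.val h.val)

/-- The inclusion functor of the subcategory `K`. -/
def incl : K.Obj ⥤ L where
  obj X := X.val
  map f := f.val
  map_id _ := rfl
  map_comp _ _ := rfl

/-- A subcategory is nearly full if its inclusion functor is. -/
def NearlyFull : Prop := K.incl.NearlyFull

variable {K} in
/-- A cocone in the ambient category, over a diagram in `K`, whose vertex and legs belong to `K`,
regarded as a cocone in `K`. -/
def liftCocone {I : Type*} [Category* I] {D : I ⥤ K.Obj} (c : Cocone (D ⋙ K.incl))
    (hpt : K.obj c.pt) (hleg : ∀ i, K.hom (c.ι.app i)) : Cocone D where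
  pt := ⟨c.pt, hpt⟩
  ι :=
    { app := fun i => ⟨c.ι.app i, hleg i⟩
      naturality := fun _ _ f => Hom.ext (c.ι.naturality f) }

/-- `K` is closed under directed colimits in `L`: for every small directed diagram in `K`, every
colimit cocone of it in `L` lies in `K` (vertex and legs) and is a colimit cocone in `K`. -/
def ClosedUnderDirectedColimits : Prop :=
  ∀ (I : Type w) [PartialOrder I] [IsDirectedOrder I] [Nonempty I] (D : I ⥤ K.Obj)
    (c : Cocone (D ⋙ K.incl)), IsColimit c →
      ∃ (hpt : K.obj c.pt) (hleg : ∀ i, K.hom (c.ι.app i)),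
        Nonempty (IsColimit (liftCocone c hpt hleg))

/-- A subcategory `K` of `Emb(S)` is an abstract elementary class if it is nearly full, closed
under directed colimits in `Emb(S)`, and there is a cardinal `lam` such that every substructure
embedding `f : A ⟶ B` with `B` in `K` factorizes through a morphism `h : A' ⟶ B` of `K` with
`|A'| ≤ |A| + lam`. -/
structure IsAbstractElementaryClass {S : FinitarySignature.{w}} (K : Subcat (EmbCat S)) :
    Prop where
  nearlyFull : K.NearlyFull
  closed : ClosedUnderDirectedColimits.{w} K
  exists_factorization : ∃ lam : Cardinal.{w}, ∀ ⦃A B : EmbCat S⦄ (f : A ⟶ B), K.obj B →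
    ∃ (A' : EmbCat S) (h : A' ⟶ B) (k : A ⟶ A'),
      K.hom h ∧ k ≫ h = f ∧ A'.card ≤ A.card + lam

end Subcat

/-! ### Embeddings, images and substructures. -/

namespace EmbCat

variable {S : FinitarySignature.{w}}

/-! Directed colimits in `Emb(S)` are unions: a cocone over a directed diagram is colimiting as soon
as its legs are jointly surjective, and such a cocone always exists. Closure under directed colimits
transports this to `K`, so elements of a filtered colimit in `K` all come from some stage.

An abstract elementary class is accessible: fix an infinite `μ` bounding `lam` and the number of
operation symbols. Closing a subset of size at most `μ` under operations and then applying the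
factorization property gives a substructure of size at most `μ` whose inclusion lies in `K`
(`exists_smallSub`). Hence each `B` is the `μ⁺`-directed union of such substructures. These are
`μ⁺`-presentable: fewer than `μ⁺` elements lie in a single stage, and near fullness puts the
resulting factorization in `K`.

Conversely, write `B` as a directed colimit of generators of size at most `lam`. Choose a stage for
each element of `A`, and extend the choice to a monotone map on finite subsets of `A`. The colimit
in `K` of the diagram so indexed has size at most `|A| + lam`, maps to `B` by a morphism of `K`, and
its image contains that of `A`. -/

lemma hom_ext {A B : EmbCat S} {f g : A ⟶ B} (h : ∀ s x, f.map s x = g.map s x) : f = g :=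
  Hom.ext (funext fun s => funext fun x => h s x)

@[simp]
lemma comp_map {A B C : EmbCat S} (f : A ⟶ B) (g : B ⟶ C) (s : S.Sorts) (x : A.carrier s) :
    (f ≫ g).map s x = g.map s (f.map s x) := rfl

lemma comp_right_cancel {A B C : EmbCat S} {f g : A ⟶ B} (h : B ⟶ C) (e : f ≫ h = g ≫ h) :
    f = g :=
  hom_ext fun s x => h.injective s (by rw [← comp_map, e, comp_map])

/-- An embedding into `C` whose image is contained in that of `g : B ⟶ C` factorizes
through `g`. -/
lemma exists_lift {A B C : EmbCat S} (f : A ⟶ C) (g : B ⟶ C)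
    (h : ∀ s x, ∃ y, g.map s y = f.map s x) : ∃ k : A ⟶ B, k ≫ g = f := by
  choose k hk using h
  refine ⟨{ map := k, injective := ?_, map_op := ?_, map_rel := ?_ }, hom_ext hk⟩
  · intro s x y e
    apply f.injective s
    rw [← hk, ← hk, e]
  · intro o x
    apply g.injective
    rw [hk, f.map_op, g.map_op]
    simp only [hk]
  · intro r x
    rw [← g.map_rel, ← f.map_rel]
    simp only [hk]

/-- A surjective embedding is an isomorphism. -/
lemma exists_iso {A B : EmbCat S} (f : A ⟶ B) (h : ∀ s y, ∃ x, f.map s x = y) :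
    ∃ e : A ≅ B, e.hom = f := by
  obtain ⟨k, hk⟩ := exists_lift (𝟙 B) f fun s x => h s _
  exact ⟨⟨f, k, comp_right_cancel f (by rw [Category.assoc, hk]; rfl), hk⟩, rfl⟩

lemma card_le_of_hom {A B : EmbCat S} (f : A ⟶ B) : A.card ≤ B.card :=
  Cardinal.mk_le_of_injective (f := fun x : Σ s, A.carrier s => (⟨x.1, f.map _ x.2⟩ : Σ s, _)) (by
    rintro ⟨s, x⟩ ⟨t, y⟩ h
    obtain ⟨h₁, h₂⟩ := Sigma.mk.inj_iff.1 h
    cases h₁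
    exact congrArg _ (f.injective s (eq_of_heq h₂)))

/-- A subset of a structure is closed under the operations. -/
def OpClosed (B : EmbCat S) (p : Set (Σ s, B.carrier s)) : Prop :=
  ∀ (o : S.Op) (x : ∀ i, B.carrier (S.opDom o i)), (∀ i, ⟨_, x i⟩ ∈ p) → ⟨_, B.op o x⟩ ∈ p

/-- The substructure of `B` on a subset that is closed under the operations. -/
def sub (B : EmbCat S) (p : Set (Σ s, B.carrier s)) (hp : B.OpClosed p) : EmbCat S where
  carrier s := {x : B.carrier s // ⟨s, x⟩ ∈ p}
  op o x := ⟨B.op o fun i => (x i).1, hp o _ fun i => (x i).2⟩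
  rel r x := B.rel r fun i => (x i).1

/-- The inclusion of a substructure. -/
def subIncl (B : EmbCat S) (p : Set (Σ s, B.carrier s)) (hp : B.OpClosed p) : B.sub p hp ⟶ B where
  map _ x := x.1
  injective _ := Subtype.val_injective
  map_op _ _ := rfl
  map_rel _ _ := Iff.rfl

@[simp]
lemma subIncl_map (B : EmbCat S) (p : Set (Σ s, B.carrier s)) (hp : B.OpClosed p) (s : S.Sorts)
    (x : (B.sub p hp).carrier s) : (B.subIncl p hp).map s x = x.1 := rfl

lemma card_sub (B : EmbCat S) (p : Set (Σ s, B.carrier s)) (hp : B.OpClosed p) :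
    (B.sub p hp).card = Cardinal.mk p :=
  Cardinal.mk_congr
    { toFun := fun x => ⟨⟨x.1, x.2.1⟩, x.2.2⟩
      invFun := fun x => ⟨x.1.1, x.1.2, x.2⟩
      left_inv := fun _ => rfl
      right_inv := fun _ => rfl }

/-- The image of an embedding. -/
def range {A B : EmbCat S} (f : A ⟶ B) : Set (Σ s, B.carrier s) :=
  {y | ∃ x, f.map y.1 x = y.2}

lemma opClosed_range {A B : EmbCat S} (f : A ⟶ B) : B.OpClosed (range f) := by
  intro o x hx
  choose y hy using hx
  refine ⟨A.op o y, ?_⟩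
  rw [f.map_op]
  exact congrArg _ (funext hy)

lemma exists_iso_sub_range {A B : EmbCat S} (f : A ⟶ B) :
    ∃ e : A ≅ B.sub (range f) (opClosed_range f), e.hom ≫ B.subIncl _ _ = f := by
  obtain ⟨k, hk⟩ := exists_lift f (B.subIncl _ (opClosed_range f)) fun s x => ⟨⟨_, x, rfl⟩, rfl⟩
  obtain ⟨e, rfl⟩ := exists_iso k (by
    rintro s ⟨y, x, hx⟩
    exact ⟨x, Subtype.ext (by rw [← subIncl_map _ _ (opClosed_range f), ← comp_map, hk, hx])⟩)
  exact ⟨e, hk⟩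

/-! ### Generated substructures and their cardinality. -/

section Generated

/-- The value of a term over a subset `p` of `B`, if the sorts of its subterms match. -/
noncomputable def termValue (B : EmbCat S) (p : Set (Σ s, B.carrier s)) :
    WType (Sum.elim (fun _ : p => Fin 0) fun o : S.Op => Fin (S.opArity o)) →
      Option (Σ s, B.carrier s) :=
  WType.elim _ fun
    | ⟨Sum.inl x, _⟩ => some x.1
    | ⟨Sum.inr o, y⟩ => by
      classical
      exact if h : ∃ x : ∀ i, B.carrier (S.opDom o i), ∀ i, y i = some ⟨_, x i⟩ then
        some ⟨_, B.op o h.choose⟩ else none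

/-- Every subset of a structure is contained in a substructure whose cardinality is at most that
of the subset, of the set of operation symbols and `ℵ₀`. -/
lemma exists_opClosed (B : EmbCat S) (p : Set (Σ s, B.carrier s)) {μ : Cardinal.{w}}
    (hμ : Cardinal.aleph0 ≤ μ) (hp : Cardinal.mk p ≤ μ) (hS : Cardinal.mk S.Op ≤ μ) :
    ∃ q, p ⊆ q ∧ B.OpClosed q ∧ Cardinal.mk q ≤ μ := by
  refine ⟨{x | ∃ t, B.termValue p t = some x}, ?_, ?_, ?_⟩
  · intro x hx
    exact ⟨⟨Sum.inl ⟨x, hx⟩, Fin.elim0⟩, rfl⟩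
  · intro o x hx
    choose t ht using hx
    refine ⟨⟨Sum.inr o, t⟩, ?_⟩
    have h : ∃ x : ∀ i, B.carrier (S.opDom o i), ∀ i, B.termValue p (t i) = some ⟨_, x i⟩ :=
      ⟨x, ht⟩
    refine (dif_pos h).trans ?_
    have : h.choose = x := by
      funext i
      have := (h.choose_spec i).symm.trans (ht i)
      simpa using this
    exact congrArg (fun z => some (⟨_, B.op o z⟩ : Σ s, B.carrier s)) this
  -- Elements of the generated substructure are values of terms; terms form a W-type with finite
  -- branching whose labels are the elements of `p` and the operation symbols.
  · have : ∀ a, Finite ((Sum.elim (fun _ : p => Fin 0) fun o : S.Op => Fin (S.opArity o)) a) := by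
      rintro (a | a) <;> simp only [Sum.elim_inl, Sum.elim_inr] <;> infer_instance
    have h1 : Cardinal.mk (WType (Sum.elim (fun _ : p => Fin 0)
        fun o : S.Op => Fin (S.opArity o))) ≤ μ := by
      refine WType.cardinalMk_le_max_aleph0_of_finite'.trans (max_le ?_ hμ)
      rw [Cardinal.lift_uzero, Cardinal.mk_sum, Cardinal.lift_id, Cardinal.lift_id]
      exact Cardinal.add_le_of_le hμ hp hS
    refine le_trans ?_ h1
    choose f hf using fun x : {x | ∃ t, B.termValue p t = some x} => x.2
    refine Cardinal.mk_le_of_injective (f := f) fun x y h => ?_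
    have := (hf x).symm.trans ((congrArg _ h).trans (hf y))
    exact Subtype.ext (Option.some.inj this)

end Generated

/-! ### Directed colimits of embeddings as unions. -/

section DirectedColimits

variable {I : Type w} [PartialOrder I] {D : I ⥤ EmbCat S}

/-- Every element of the vertex of the cocone is in the image of a leg. -/
def JointlySurjective {J : Type*} [Category* J] {D : J ⥤ EmbCat S} (c : Cocone D) : Prop :=
  ∀ s (x : c.pt.carrier s), ∃ i y, (c.ι.app i).map s y = x

lemma cocone_w_apply {J : Type*} [Category* J] {D : J ⥤ EmbCat S} (c : Cocone D) {i j : J}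
    (f : i ⟶ j) (s : S.Sorts) (x : (D.obj i).carrier s) :
    (c.ι.app j).map s ((D.map f).map s x) = (c.ι.app i).map s x := by
  rw [← c.w f]; rfl

lemma cocone_map_op {J : Type*} [Category* J] {D : J ⥤ EmbCat S} (c : Cocone D) (j : J)
    (o : S.Op) (x : ∀ a, (D.obj j).carrier (S.opDom o a)) :
    (c.ι.app j).map _ ((D.obj j).op o x) = c.pt.op o fun a => (c.ι.app j).map _ (x a) :=
  (c.ι.app j).map_op o x

lemma JointlySurjective.exists_tuple [IsDirectedOrder I] [Nonempty I] {c : Cocone D}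
    (hc : JointlySurjective c) {n : ℕ} {t : Fin n → S.Sorts} (x : ∀ a, c.pt.carrier (t a)) :
    ∃ (i : I) (y : ∀ a, (D.obj i).carrier (t a)), ∀ a, (c.ι.app i).map _ (y a) = x a := by
  choose i y hy using fun a => hc _ (x a)
  obtain ⟨k, hk⟩ := Finite.exists_le i
  exact ⟨k, fun a => (D.map (homOfLE (hk a))).map _ (y a), fun a => by
    rw [cocone_w_apply, hy]⟩

/-- Since legs are injective, equality in one cocone already holds at a common later stage, hence in
every cocone. This gives both well-definedness and injectivity of the comparison map out of a
jointly surjective cocone. -/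
lemma cocone_app_eq_of_app_eq [IsDirectedOrder I] (c c' : Cocone D) {s : S.Sorts} {i j : I}
    {x : (D.obj i).carrier s} {y : (D.obj j).carrier s}
    (h : (c.ι.app i).map s x = (c.ι.app j).map s y) :
    (c'.ι.app i).map s x = (c'.ι.app j).map s y := by
  obtain ⟨k, hi, hj⟩ := exists_ge_ge i j
  rw [← cocone_w_apply c (homOfLE hi), ← cocone_w_apply c (homOfLE hj)] at h
  rw [← cocone_w_apply c' (homOfLE hi), ← cocone_w_apply c' (homOfLE hj),
    (c.ι.app k).injective s h]

/-- A jointly surjective cocone over a directed diagram is a colimit cocone. -/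
lemma JointlySurjective.nonempty_isColimit [IsDirectedOrder I] [Nonempty I] {c : Cocone D}
    (hc : JointlySurjective c) : Nonempty (IsColimit c) := by
  have key : ∀ c' : Cocone D, ∃ f : c.pt ⟶ c'.pt, ∀ i, c.ι.app i ≫ f = c'.ι.app i := by
    intro c'
    choose i y hy using hc
    have hd : ∀ j s x, (c'.ι.app _).map s (y s ((c.ι.app j).map s x)) = (c'.ι.app j).map s x :=
      fun j s x => cocone_app_eq_of_app_eq c c' (hy _ _)
    refine ⟨{ map := fun s x => (c'.ι.app (i s x)).map s (y s x), injective := ?_, map_op := ?_,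
              map_rel := ?_ }, fun j => hom_ext (hd j)⟩
    · intro s x x' h
      rw [← hy s x, ← hy s x']
      exact cocone_app_eq_of_app_eq c' c h
    · intro o x
      obtain ⟨j, z, hz⟩ := JointlySurjective.exists_tuple (fun s x => ⟨i s x, y s x, hy s x⟩) x
      obtain rfl : (fun a => (c.ι.app j).map _ (z a)) = x := funext hz
      simp only [hd, ← cocone_map_op c']
      rw [← hd j _ ((D.obj j).op o z), cocone_map_op c]
    · intro r x
      obtain ⟨j, z, hz⟩ := JointlySurjective.exists_tuple (fun s x => ⟨i s x, y s x, hy s x⟩) x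
      obtain rfl : (fun a => (c.ι.app j).map _ (z a)) = x := funext hz
      simp only [hd]
      exact ((c'.ι.app j).map_rel r z).trans ((c.ι.app j).map_rel r z).symm
  choose f hf using key
  refine ⟨{ desc := f, fac := hf, uniq := fun c' m hm => hom_ext fun s x => ?_ }⟩
  obtain ⟨i, y, rfl⟩ := hc s x
  rw [← comp_map, ← comp_map, hm, hf]

variable (D) in
/-- The relation identifying elements of a directed diagram that become equal later on. -/
def colimitSetoid [IsDirectedOrder I] (s : S.Sorts) : Setoid (Σ i, (D.obj i).carrier s) where
  r x y := ∃ (k : I) (hx : x.1 ≤ k) (hy : y.1 ≤ k),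
    (D.map (homOfLE hx)).map s x.2 = (D.map (homOfLE hy)).map s y.2
  iseqv :=
    { refl := fun x => ⟨x.1, le_rfl, le_rfl, rfl⟩
      symm := fun ⟨k, hx, hy, h⟩ => ⟨k, hy, hx, h.symm⟩
      trans := by
        rintro x y z ⟨k, hx, hy, h⟩ ⟨l, hy', hz, h'⟩
        obtain ⟨m, hk, hl⟩ := exists_ge_ge k l
        refine ⟨m, hx.trans hk, hz.trans hl, ?_⟩
        rw [← homOfLE_comp hx hk, ← homOfLE_comp hz hl, D.map_comp, D.map_comp, comp_map, comp_map,
          h, ← h', ← comp_map, ← comp_map, ← D.map_comp, ← D.map_comp]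
        rfl }

variable (D) in
/-- Every directed diagram of embeddings has a jointly surjective cocone. -/
lemma exists_jointlySurjective [IsDirectedOrder I] [Nonempty I] :
    ∃ c : Cocone D, JointlySurjective c := by
  let C : S.Sorts → Type w := fun s => Quotient (colimitSetoid D s)
  let ι : ∀ i s, (D.obj i).carrier s → C s := fun i s x => Quotient.mk _ ⟨i, x⟩
  have hι : ∀ i j (f : i ⟶ j) s x, ι j s ((D.map f).map s x) = ι i s x := fun i j f s x =>
    Quotient.sound ⟨j, le_rfl, leOfHom f, by
      rw [← comp_map, ← D.map_comp]; rfl⟩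
  have hinj : ∀ i s, Function.Injective (ι i s) := by
    intro i s x y h
    obtain ⟨k, h₁, h₂, h⟩ := Quotient.exact h
    exact (D.map _).injective s h
  have hex : ∀ {n : ℕ} (t : Fin n → S.Sorts) (x : ∀ a, C (t a)),
      ∃ (i : I) (y : ∀ a, (D.obj i).carrier (t a)), ∀ a, ι i _ (y a) = x a := by
    intro n t x
    choose y hy using fun a => Quotient.exists_rep (x a)
    obtain ⟨k, hk⟩ := Finite.exists_le fun a => (y a).1
    exact ⟨k, fun a => (D.map (homOfLE (hk a))).map _ (y a).2, fun a => by rw [hι, ← hy]⟩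
  have hlift : ∀ {n : ℕ} (t : Fin n → S.Sorts) (i j : I) (x : ∀ a, (D.obj i).carrier (t a))
      (y : ∀ a, (D.obj j).carrier (t a)), (∀ a, ι i _ (x a) = ι j _ (y a)) →
      ∃ (k : I) (f : i ⟶ k) (g : j ⟶ k),
        ∀ a, (D.map f).map _ (x a) = (D.map g).map _ (y a) := by
    intro n t i j x y h
    obtain ⟨k, hi, hj⟩ := exists_ge_ge i j
    exact ⟨k, homOfLE hi, homOfLE hj, fun a => hinj k _ (by rw [hι, hι, h])⟩
  -- Finite arity lets each tuple be represented at one stage. Operations and relations are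
  -- evaluated on a chosen representative; by `hlift` any two representatives agree at a later
  -- stage, which makes the legs embeddings.
  choose idx rep hrep using @hex
  let E : EmbCat S :=
    { carrier := C
      op := fun o x => ι (idx _ x) _ ((D.obj _).op o (rep _ x))
      rel := fun r x => (D.obj _).rel r (rep _ x) }
  let leg : ∀ i, D.obj i ⟶ E := fun i =>
    { map := ι i
      injective := hinj i
      map_op := fun o x => by
        obtain ⟨k, f, g, h⟩ := hlift _ i _ x (rep _ fun a => ι i _ (x a)) fun a =>
          (hrep _ (fun a => ι i _ (x a)) a).symm
        change _ = ι _ _ _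
        rw [← hι _ _ f, ← hι _ _ g, (D.map f).map_op, (D.map g).map_op]
        simp only [h]
      map_rel := fun r x => by
        obtain ⟨k, f, g, h⟩ := hlift _ i _ x (rep _ fun a => ι i _ (x a)) fun a =>
          (hrep _ (fun a => ι i _ (x a)) a).symm
        change (D.obj _).rel r _ ↔ _
        rw [← (D.map f).map_rel, ← (D.map g).map_rel]
        simp only [h] }
  refine ⟨{ pt := E, ι := { app := leg, naturality := fun i j f => hom_ext (hι i j f) } }, ?_⟩
  intro s x
  obtain ⟨⟨i, y⟩, rfl⟩ := Quotient.exists_rep x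
  exact ⟨i, y, rfl⟩

end DirectedColimits

/-! ### Bounding isomorphism classes and cardinalities. -/

/-- A structure whose underlying sets are subsets of a fixed type `T`. -/
structure Code (S : FinitarySignature.{w}) (T : Type w) : Type w where
  /-- the underlying set of each sort -/
  carrier : S.Sorts → Set T
  /-- the interpretation of the operation symbols -/
  op : ∀ o : S.Op, (∀ i, carrier (S.opDom o i)) → carrier (S.opCod o)
  /-- the interpretation of the relation symbols -/
  rel : ∀ r : S.Rel, (∀ i, carrier (S.relDom r i)) → Prop

/-- The structure described by a code. -/
def Code.toEmbCat {T : Type w} (C : Code S T) : EmbCat S where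
  carrier s := C.carrier s
  op := C.op
  rel := C.rel

/-- Codes over a fixed `T` form a type in universe `w`, so structures of bounded cardinality have
only a set of isomorphism classes. -/
lemma exists_iso_code (A : EmbCat S) {T : Type w} (h : A.card ≤ Cardinal.mk T) :
    ∃ C : Code S T, Nonempty (A ≅ C.toEmbCat) := by
  obtain ⟨e⟩ := h
  let p : S.Sorts → Set T := fun s => Set.range fun x : A.carrier s => e ⟨s, x⟩
  let E : ∀ s, A.carrier s ≃ p s := fun s => Equiv.ofInjective _ fun x y h => by
    simpa using e.injective h
  let C : Code S T :=
    { carrier := p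
      op := fun o x => E _ (A.op o fun i => (E _).symm (x i))
      rel := fun r x => A.rel r fun i => (E _).symm (x i) }
  let f : A ⟶ C.toEmbCat :=
    { map := fun s x => E s x
      injective := fun s => (E s).injective
      map_op := fun o x => by
        change E _ _ = E _ _
        simp only [Equiv.symm_apply_apply]
      map_rel := fun r x => by
        change A.rel r _ ↔ _
        simp only [Equiv.symm_apply_apply] }
  obtain ⟨e', -⟩ := exists_iso f fun s y => (E s).surjective y
  exact ⟨C, ⟨e'⟩⟩

/-- The inclusion between two substructures. -/
def subMap (B : EmbCat S) {p q : Set (Σ s, B.carrier s)} (hp : B.OpClosed p) (hq : B.OpClosed q)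
    (h : p ⊆ q) : B.sub p hp ⟶ B.sub q hq where
  map _ x := ⟨x.1, h x.2⟩
  injective _ _ _ e := Subtype.ext (congrArg (fun z : (B.sub q hq).carrier _ => z.1) e)
  map_op _ _ := rfl
  map_rel _ _ := Iff.rfl

lemma card_le_of_jointlySurjective {I : Type w} [Category.{w} I] {D : I ⥤ EmbCat S} {c : Cocone D}
    (hc : JointlySurjective c) {μ : Cardinal.{w}} (hμ : ∀ i, (D.obj i).card ≤ μ) :
    c.pt.card ≤ Cardinal.mk I * μ := by
  have h : Function.Surjective fun x : Σ i, Σ s, (D.obj i).carrier s =>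
      (⟨x.2.1, (c.ι.app x.1).map _ x.2.2⟩ : Σ s, c.pt.carrier s) := by
    rintro ⟨s, x⟩
    obtain ⟨i, y, rfl⟩ := hc s x
    exact ⟨⟨i, s, y⟩, rfl⟩
  refine (Cardinal.mk_le_of_surjective h).trans ?_
  rw [Cardinal.mk_sigma, ← Cardinal.sum_const']
  exact Cardinal.sum_le_sum _ _ hμ

end EmbCat

/-- In a directed order, the finite subsets of a family have upper bounds that are chosen
monotonically. -/
lemma exists_monotone_finset_upperBound {T α : Type*} [PartialOrder α] [IsDirectedOrder α]
    [Nonempty α] (g : T → α) :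
    ∃ F : Finset T → α, Monotone F ∧ ∀ s, ∀ t ∈ s, g t ≤ F s := by
  classical
  -- Recursion on strict inclusion: the value at `s` must bound `g` on `s` and the values already
  -- chosen at the finitely many proper subsets of `s`.
  have ex : ∀ (s : Finset T) (ih : ∀ t ⊂ s, α),
      ∃ M, (∀ t ∈ s, g t ≤ M) ∧ ∀ t (h : t ⊂ s), ih t h ≤ M := by
    intro s ih
    have : Finite {t // t ⊂ s} :=
      Finite.of_injective (β := s.powerset)
        (fun t => ⟨t.1, Finset.mem_powerset.2 t.2.subset⟩)
        (fun a b h => Subtype.ext (congrArg (fun z : s.powerset => z.1) h))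
    obtain ⟨M, hM⟩ := Finite.exists_le (Sum.elim (fun t : s => g t.1)
      fun t : {t // t ⊂ s} => ih t.1 t.2)
    exact ⟨M, fun t ht => hM (Sum.inl ⟨t, ht⟩), fun t ht => hM (Sum.inr ⟨t, ht⟩)⟩
  choose ub h₁ h₂ using ex
  refine ⟨Finset.strongInduction ub, fun s t hst => ?_, fun s t ht => ?_⟩
  · obtain rfl | h := hst.eq_or_ssubset
    · exact le_rfl
    · rw [Finset.strongInduction_eq ub t]
      exact h₂ t (fun t _ => Finset.strongInduction ub t) s h
  · rw [Finset.strongInduction_eq]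
    exact h₁ s _ t ht

lemma mk_finset_le (T : Type w) : Cardinal.mk (Finset T) ≤ max (Cardinal.mk T) Cardinal.aleph0 := by
  cases finite_or_infinite T
  · exact (Cardinal.mk_le_aleph0 (α := Finset T)).trans (le_max_right _ _)
  · rw [Cardinal.mk_finset_of_infinite]
    exact le_max_left _ _

/-! ### Colimits and presentable objects in `K`. -/

namespace Subcat

variable {S : FinitarySignature.{w}} {K : Subcat (EmbCat S)}

lemma exists_jointlySurjective_isColimit (hcl : ClosedUnderDirectedColimits.{w} K)
    {I : Type w} [PartialOrder I] [IsDirectedOrder I] [Nonempty I] (D : I ⥤ K.Obj) :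
    ∃ c : Cocone D, Nonempty (IsColimit c) ∧
      EmbCat.JointlySurjective (K.incl.mapCocone c) := by
  obtain ⟨c, hc⟩ := EmbCat.exists_jointlySurjective (D ⋙ K.incl)
  obtain ⟨hpt, hleg, h⟩ := hcl I D c hc.nonempty_isColimit.some
  exact ⟨_, h, hc⟩

/-- Map an element `x` into a jointly surjective colimit cocone. Its image comes from some stage,
and injectivity of the comparison map shows that `x` comes from the same element of that stage. -/
lemma jointlySurjective_of_isColimit_of_directed (hcl : ClosedUnderDirectedColimits.{w} K)
    {I : Type w} [PartialOrder I] [IsDirectedOrder I] [Nonempty I] {D : I ⥤ K.Obj} {c : Cocone D}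
    (hc : IsColimit c) : EmbCat.JointlySurjective (K.incl.mapCocone c) := by
  obtain ⟨c', ⟨hc'⟩, h⟩ := exists_jointlySurjective_isColimit hcl D
  intro s x
  obtain ⟨i, y, hy⟩ := h s ((hc.desc c').val.map s x)
  refine ⟨i, y, (hc.desc c').val.injective s ?_⟩
  rw [← hy]
  exact congrArg (fun f : D.obj i ⟶ c'.pt => f.val.map s y) (hc.fac c' i)

/-- The legs of a filtered colimit cocone in `K` are jointly surjective. -/
lemma jointlySurjective_of_isColimit (hcl : ClosedUnderDirectedColimits.{w} K)
    {J : Type w} [SmallCategory J] [IsFiltered J] {D : J ⥤ K.Obj} {c : Cocone D}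
    (hc : IsColimit c) : EmbCat.JointlySurjective (K.incl.mapCocone c) := by
  obtain ⟨I, _, _, _, G, _⟩ := IsFiltered.exists_directed J
  intro s x
  obtain ⟨i, y, hy⟩ := jointlySurjective_of_isColimit_of_directed hcl
    ((Functor.Final.isColimitWhiskerEquiv G c).symm hc) s x
  exact ⟨G.obj i, y, hy⟩

lemma hasColimitsOfShape_of_isFiltered (hcl : ClosedUnderDirectedColimits.{w} K)
    (J : Type w) [SmallCategory J] [IsFiltered J] : HasColimitsOfShape J K.Obj := by
  obtain ⟨I, _, _, _, G, _⟩ := IsFiltered.exists_directed J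
  have : HasColimitsOfShape I K.Obj := ⟨fun D => by
    obtain ⟨c, ⟨hc⟩, -⟩ := exists_jointlySurjective_isColimit hcl D
    exact ⟨⟨c, hc⟩⟩⟩
  exact Functor.Final.hasColimitsOfShape_of_final G

/-- A subcategory that is closed under directed colimits contains all isomorphisms from its
objects. -/
lemma hom_of_iso (hcl : ClosedUnderDirectedColimits.{w} K) {X Y : EmbCat S} (hX : K.obj X)
    (e : X ≅ Y) : K.hom e.hom := by
  -- The isomorphism is the leg of a colimit cocone over a constant one-point diagram, and closure
  -- puts such legs in `K`.
  let D : PUnit.{w + 1} ⥤ K.Obj := (Functor.const _).obj ⟨X, hX⟩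
  let c : Cocone (D ⋙ K.incl) :=
    { pt := Y
      ι := { app := fun _ => e.hom, naturality := fun _ _ _ => by
              change 𝟙 X ≫ e.hom = e.hom ≫ 𝟙 Y
              simp } }
  have hc : EmbCat.JointlySurjective c := fun s x =>
    ⟨⟨⟩, e.inv.map s x, by
      change (e.inv ≫ e.hom).map s x = x
      rw [e.inv_hom_id]; rfl⟩
  obtain ⟨-, hleg, -⟩ := hcl PUnit D c hc.nonempty_isColimit.some
  exact hleg ⟨⟩

lemma nonempty_iso (hcl : ClosedUnderDirectedColimits.{w} K) {X Y : K.Obj} (e : X.val ≅ Y.val) :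
    Nonempty (X ≅ Y) :=
  ⟨⟨⟨e.hom, hom_of_iso hcl X.property e⟩, ⟨e.inv, hom_of_iso hcl Y.property e.symm⟩,
    Hom.ext e.hom_inv_id, Hom.ext e.inv_hom_id⟩⟩

/-- Small structures are presentable. -/
lemma isCardinalPresentable_of_card_lt (hK : K.NearlyFull)
    (hcl : ClosedUnderDirectedColimits.{w} K) (κ : Cardinal.{w}) [Fact κ.IsRegular] (A : K.Obj)
    (hA : A.val.card < κ) : IsCardinalPresentable A κ where
  preservesColimitOfShape J _ _ := by
    have := isFiltered_of_isCardinalFiltered J κ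
    refine ⟨fun {D} => ⟨fun {c} hc => ⟨Types.FilteredColimit.isColimitOf' _ _ ?_ ?_⟩⟩⟩
    · intro (f : A ⟶ c.pt)
      choose j y hy using fun x : Σ s, A.val.carrier s =>
        jointlySurjective_of_isColimit hcl hc x.1 (f.val.map _ x.2)
      have hlt : HasCardinalLT (Σ s, A.val.carrier s) κ := by
        rw [hasCardinalLT_iff_cardinal_mk_lt]; exact hA
      -- Fewer than `κ` stages are involved, so one stage `m` contains the whole image of `f`.
      let m : J := IsCardinalFiltered.max j hlt
      obtain ⟨k, hk⟩ := EmbCat.exists_lift f.val (c.ι.app m).val fun s x =>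
        ⟨(D.map (IsCardinalFiltered.toMax j hlt ⟨s, x⟩)).val.map s (y ⟨s, x⟩),
          (EmbCat.cocone_w_apply (K.incl.mapCocone c)
            (IsCardinalFiltered.toMax j hlt ⟨s, x⟩) s (y ⟨s, x⟩)).trans (hy ⟨s, x⟩)⟩
      obtain ⟨k', rfl⟩ := hK f (c.ι.app m) k hk
      exact ⟨m, k', Hom.ext hk.symm⟩
    · intro j (f : A ⟶ D.obj j) (g : A ⟶ D.obj j) (h : f ≫ c.ι.app j = g ≫ c.ι.app j)
      refine ⟨j, 𝟙 j, ?_⟩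
      have : f = g := Hom.ext (EmbCat.comp_right_cancel (c.ι.app j).val (congrArg Hom.val h))
      rw [this]

/-- There is only a set of structures of bounded cardinality, up to isomorphism. -/
lemma essentiallySmall_card_le (hcl : ClosedUnderDirectedColimits.{w} K) (μ : Cardinal.{w}) :
    ObjectProperty.EssentiallySmall.{w} (fun X : K.Obj => X.val.card ≤ μ) := by
  let Q : ObjectProperty K.Obj := fun X => ∃ C : EmbCat.Code S μ.out, C.toEmbCat = X.val
  have hQ : ObjectProperty.Small.{w} Q :=
    small_of_surjective (α := {C : EmbCat.Code S μ.out // K.obj C.toEmbCat})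
      (f := fun C => (⟨⟨C.1.toEmbCat, C.2⟩, C.1, rfl⟩ : Subtype Q)) (by
        rintro ⟨⟨X, hX⟩, C, hC⟩
        change C.toEmbCat = X at hC
        subst hC
        exact ⟨⟨C, hX⟩, rfl⟩)
  refine ⟨Q, hQ, fun X hX => ?_⟩
  obtain ⟨C, ⟨e⟩⟩ := X.val.exists_iso_code (T := μ.out) (by rw [Cardinal.mk_out]; exact hX)
  exact ⟨⟨C.toEmbCat, K.target_mem _ (hom_of_iso hcl X.property e)⟩, ⟨C, rfl⟩,
    nonempty_iso hcl e⟩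

/-! ### From abstract elementary classes to accessibility. -/

variable (K) in
/-- The substructures of `B` of cardinality at most `μ` whose inclusion belongs to `K`. -/
def SmallSub (B : EmbCat S) (μ : Cardinal.{w}) : Type w :=
  {p : Set (Σ s, B.carrier s) // (∃ hp : B.OpClosed p, K.hom (B.subIncl p hp)) ∧
    Cardinal.mk p ≤ μ}

instance (B : EmbCat S) (μ : Cardinal.{w}) : PartialOrder (K.SmallSub B μ) :=
  inferInstanceAs (PartialOrder (Subtype _))

/-- The factorization property is applied to the substructure generated by `p`, and the object found
is replaced by its image in `B`, which is harmless because `K` contains isomorphisms from its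
objects. -/
lemma exists_smallSub (h : K.IsAbstractElementaryClass) :
    ∃ lam : Cardinal.{w}, ∀ (B : EmbCat S), K.obj B → ∀ μ : Cardinal.{w}, lam ≤ μ →
      Cardinal.aleph0 ≤ μ → Cardinal.mk S.Op ≤ μ → ∀ p : Set (Σ s, B.carrier s),
        Cardinal.mk p ≤ μ → ∃ q : K.SmallSub B μ, p ⊆ q.1 := by
  obtain ⟨lam, hlam⟩ := h.exists_factorization
  refine ⟨lam, fun B hB μ h₁ h₂ h₃ p hp => ?_⟩
  obtain ⟨q, hpq, hq, hqμ⟩ := B.exists_opClosed p h₂ hp h₃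
  obtain ⟨A, f, k, hf, hk, hA⟩ := hlam (B.subIncl q hq) hB
  obtain ⟨e, he⟩ := EmbCat.exists_iso_sub_range f
  have hr : K.hom (B.subIncl _ (EmbCat.opClosed_range f)) := by
    have hA' := K.source_mem f hf
    have hi : K.hom e.inv := hom_of_iso h.closed
      (K.target_mem _ (hom_of_iso h.closed hA' e)) e.symm
    rw [← e.inv_hom_id_assoc (B.subIncl _ (EmbCat.opClosed_range f)), he]
    exact K.comp_mem _ _ hi hf
  refine ⟨⟨EmbCat.range f, ⟨_, hr⟩, ?_⟩, ?_⟩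
  · rw [← EmbCat.card_sub _ _ (EmbCat.opClosed_range f)]
    refine (EmbCat.card_le_of_hom e.inv).trans (hA.trans ?_)
    rw [EmbCat.card_sub]
    exact Cardinal.add_le_of_le h₂ hqμ h₁
  · rintro ⟨s, x⟩ hx
    refine ⟨k.map s ⟨x, hpq hx⟩, ?_⟩
    change (k ≫ f).map s ⟨x, hpq hx⟩ = x
    rw [hk]
    rfl

lemma SmallSub.opClosed {B : EmbCat S} {μ : Cardinal.{w}} (p : K.SmallSub B μ) :
    B.OpClosed p.1 := p.2.1.choose

lemma SmallSub.hom_subIncl {B : EmbCat S} {μ : Cardinal.{w}} (p : K.SmallSub B μ) :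
    K.hom (B.subIncl p.1 p.opClosed) := p.2.1.choose_spec

/-- A small substructure, as an object of `K`. -/
def SmallSub.toObj {B : EmbCat S} {μ : Cardinal.{w}} (p : K.SmallSub B μ) : K.Obj :=
  ⟨B.sub p.1 p.opClosed, K.source_mem _ p.hom_subIncl⟩

lemma SmallSub.hom_subMap (hK : K.NearlyFull) {B : K.Obj} {μ : Cardinal.{w}}
    {p q : K.SmallSub B.val μ} (h : p ≤ q) : K.hom (B.val.subMap p.opClosed q.opClosed h) := by
  obtain ⟨f, hf⟩ := hK (A := p.toObj) (B := q.toObj) (C := B) ⟨_, p.hom_subIncl⟩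
    ⟨_, q.hom_subIncl⟩ (B.val.subMap p.opClosed q.opClosed h) rfl
  rw [← hf]
  exact f.property

/-- The diagram of the small substructures of `B` that belong to `K`. -/
def smallSubFunctor (hK : K.NearlyFull) (B : K.Obj) (μ : Cardinal.{w}) :
    K.SmallSub B.val μ ⥤ K.Obj where
  obj p := p.toObj
  map {p q} f := ⟨B.val.subMap p.opClosed q.opClosed (leOfHom f), SmallSub.hom_subMap hK _⟩
  map_id _ := rfl
  map_comp _ _ := rfl

/-- `B`, as a cocone over its small substructures that belong to `K`. -/
def smallSubCocone (hK : K.NearlyFull) (B : K.Obj) (μ : Cardinal.{w}) :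
    Cocone (smallSubFunctor hK B μ ⋙ K.incl) where
  pt := B.val
  ι :=
    { app := fun p => B.val.subIncl p.1 p.opClosed
      naturality := fun _ _ _ => rfl }

/-- An abstract elementary class is accessible. -/
lemma IsAbstractElementaryClass.isAccessibleCategory (h : K.IsAbstractElementaryClass) :
    IsAccessibleCategory.{w} K.Obj := by
  have hK := h.nearlyFull
  have hcl := h.closed
  obtain ⟨lam, hlam⟩ := exists_smallSub h
  let μ : Cardinal.{w} := max lam (max Cardinal.aleph0 (Cardinal.mk S.Op))
  have hμ₁ : lam ≤ μ := le_max_left _ _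
  have hμ₂ : Cardinal.aleph0 ≤ μ := (le_max_left _ _).trans (le_max_right _ _)
  have hμ₃ : Cardinal.mk S.Op ≤ μ := (le_max_right _ _).trans (le_max_right _ _)
  have hreg : Fact (Order.succ μ).IsRegular := ⟨Cardinal.isRegular_succ hμ₂⟩
  have hsmall := essentiallySmall_card_le hcl μ
  have hgen : ObjectProperty.IsCardinalFilteredGenerator
      (fun X : K.Obj => X.val.card ≤ μ) (Order.succ μ) :=
    { le_isCardinalPresentable := fun A hA =>
        isCardinalPresentable_of_card_lt hK hcl _ A (Order.lt_succ_of_le hA)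
      exists_colimitsOfShape := fun B => by
        have hB := fun p hp => hlam B.val B.property μ hμ₁ hμ₂ hμ₃ p hp
        have hfil : IsCardinalFiltered (K.SmallSub B.val μ) (Order.succ μ) := by
          refine isCardinalFiltered_preorder _ _ fun T s hT => ?_
          -- At most `μ` sets of size at most `μ` have a union of size at most `μ`, which lies in a
          -- single small substructure.
          obtain ⟨q, hq⟩ := hB (⋃ t, (s t).1) (by
            refine (Cardinal.mk_iUnion_le_sum_mk).trans ?_
            refine (Cardinal.sum_le_sum _ (fun _ => μ) fun t => (s t).2.2).trans ?_
            rw [Cardinal.sum_const']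
            exact (mul_le_mul' (Order.lt_succ_iff.1 hT) le_rfl).trans
              (Cardinal.mul_eq_self hμ₂).le)
          exact ⟨q, fun t => (Set.subset_iUnion _ t).trans hq⟩
        have := isFiltered_of_isCardinalFiltered (K.SmallSub B.val μ) (Order.succ μ)
        have : IsDirectedOrder (K.SmallSub B.val μ) := IsFiltered.isDirectedOrder _
        have : Nonempty (K.SmallSub B.val μ) := IsFiltered.nonempty
        have hsurj : EmbCat.JointlySurjective (smallSubCocone hK B μ) := by
          intro s (x : B.val.carrier s)
          obtain ⟨q, hq⟩ := hB {⟨s, x⟩} (by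
            rw [Cardinal.mk_singleton]; exact Cardinal.one_le_aleph0.trans hμ₂)
          exact ⟨q, (⟨x, hq rfl⟩ : {x : B.val.carrier s // ⟨s, x⟩ ∈ q.1}), rfl⟩
        obtain ⟨hpt, hleg, ⟨hc⟩⟩ := hcl _ _ _ hsurj.nonempty_isColimit.some
        refine ⟨_, inferInstance, hfil,
          ⟨⟨⟨smallSubFunctor hK B μ, (liftCocone _ hpt hleg).ι, hc⟩, fun p => ?_⟩⟩⟩
        exact (B.val.card_sub _ p.opClosed).trans_le p.2.2 }
  have := hgen.hasCardinalFilteredGenerator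
  exact ⟨Order.succ μ, hreg,
    { hasColimitsOfShape := fun J _ _ => by
        have := isFiltered_of_isCardinalFiltered J (Order.succ μ)
        exact hasColimitsOfShape_of_isFiltered hcl J }⟩

/-! ### From accessibility to the factorization property. -/

/-- An accessible subcategory that is closed under directed colimits satisfies the downward
Löwenheim–Skolem property. -/
lemma exists_factorization_of_isAccessibleCategory (hcl : ClosedUnderDirectedColimits.{w} K)
    (h : IsAccessibleCategory.{w} K.Obj) :
    ∃ lam : Cardinal.{w}, ∀ ⦃A B : EmbCat S⦄ (f : A ⟶ B), K.obj B →
      ∃ (A' : EmbCat S) (h : A' ⟶ B) (k : A ⟶ A'),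
        K.hom h ∧ k ≫ h = f ∧ A'.card ≤ A.card + lam := by
  classical
  obtain ⟨κ, _, _⟩ := h.exists_cardinal
  obtain ⟨P, _, hP⟩ := HasCardinalFilteredGenerator.exists_small_generator K.Obj κ
  let lam : Cardinal.{w} := max Cardinal.aleph0 (⨆ X : Subtype P, X.1.val.card)
  have hlam : ∀ X, P X → X.val.card ≤ lam := fun X hX =>
    (le_ciSup (f := fun X : Subtype P => X.1.val.card) Cardinal.bddAbove_of_small ⟨X, hX⟩).trans
      (le_max_right _ _)
  have hlam₀ : Cardinal.aleph0 ≤ lam := le_max_left _ _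
  refine ⟨lam, fun A B f hB => ?_⟩
  obtain ⟨J, _, _, ⟨p⟩⟩ := hP.exists_colimitsOfShape ⟨B, hB⟩
  have := isFiltered_of_isCardinalFiltered J κ
  -- Plain directedness suffices from here on: a final functor from a directed poset keeps the
  -- colimit.
  obtain ⟨I, _, _, _, G, _⟩ := IsFiltered.exists_directed J
  let c : Cocone (G ⋙ p.diag) := (Cocone.mk _ p.ι).whisker G
  have hc : IsColimit c := (Functor.Final.isColimitWhiskerEquiv G _).symm p.isColimit
  choose i y hy using fun x : Σ s, A.carrier s =>
    jointlySurjective_of_isColimit_of_directed hcl hc x.1 (f.map _ x.2)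
  obtain ⟨F, hF, hFi⟩ := exists_monotone_finset_upperBound i
  obtain ⟨c', ⟨hc'⟩, hs⟩ := exists_jointlySurjective_isColimit hcl
    (hF.functor ⋙ G ⋙ p.diag)
  -- The colimit over finite subsets of `A` is taken in `K`, so its universal property yields a
  -- morphism of `K` to `B`. Singletons then ensure that its image contains that of `f`.
  let m : c'.pt ⟶ ⟨B, hB⟩ := hc'.desc (c.whisker hF.functor)
  obtain ⟨k, hk⟩ := EmbCat.exists_lift f m.val fun s x => by
    have hle : i ⟨s, x⟩ ≤ F {⟨s, x⟩} := hFi _ _ (Finset.mem_singleton_self _)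
    let t : Finset (Σ s, A.carrier s) := {⟨s, x⟩}
    let z : (p.diag.obj (G.obj (F t))).val.carrier s := ((G ⋙ p.diag).map (homOfLE hle)).val.map s (y ⟨s, x⟩)
    refine ⟨(c'.ι.app t).val.map s z, ?_⟩
    refine (congrArg (fun g : p.diag.obj (G.obj (F t)) ⟶ _ => g.val.map s z)
      (hc'.fac (c.whisker hF.functor) t)).trans ?_
    exact (EmbCat.cocone_w_apply (K.incl.mapCocone c) (homOfLE hle) s _).trans (hy ⟨s, x⟩)
  refine ⟨c'.pt.val, m.val, k, m.property, hk, ?_⟩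
  refine (EmbCat.card_le_of_jointlySurjective hs
    fun t => hlam _ (p.prop_diag_obj (G.obj (F t)))).trans ?_
  -- At most `max |A| ℵ₀` pieces, each of size at most `lam`; the `ℵ₀` is absorbed because it was
  -- built into `lam`.
  refine (mul_le_mul' (mk_finset_le _) le_rfl).trans ?_
  refine (Cardinal.mul_le_max_of_aleph0_le_right hlam₀).trans ?_
  exact max_le (max_le (self_le_add_right _ _) (hlam₀.trans (self_le_add_left _ _)))
    (self_le_add_left _ _)

end Subcat

theorem theorem5p5 (S : FinitarySignature.{w}) (K : Subcat (EmbCat S)) (hK : K.NearlyFull) :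
    K.IsAbstractElementaryClass ↔
      IsAccessibleCategory.{w} K.Obj ∧ Subcat.ClosedUnderDirectedColimits.{w} K :=
  ⟨fun h => ⟨h.isAccessibleCategory, h.closed⟩, fun ⟨h, hcl⟩ =>
    ⟨hK, hcl, Subcat.exists_factorization_of_isAccessibleCategory hcl h⟩⟩
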